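/- Let $d\ge 3$ and let $[\mathbf a,\mathbf b]=\prod_{i=1}^d[a_i,b_i]\subset\mathbb R^d$ be a box with all side lengths $b_i-a_i\ge s>0$. Write $|\cdot|$ for the maximum norm. Consider functions $\mathbf f=(f_1,\dots,f_d):[\mathbf a,\mathbf b]\to\mathbb R^d$. Such a function is *$L$-Lipschitz* if $|\mathbf f(\mathbf x)-\mathbf f(\mathbf y)|\le L|\mathbf x-\mathbf y|$ for all $\mathbf x,\mathbf y$, and *positive-switching* if, for every $i$ and every $\mathbf x\in[\mathbf a,\mathbf b]$, $x_i=a_i$ implies $f_i(\mathbf x)\le 0$ and $x_i=b_i$ implies $f_i(\mathbf x)\ge 0$. The $d$ *diagonal conditions* are that $f_i$ is weakly increasing in $x_i$ (the other variables being fixed), and the $d^2-d$ *ex-diagonal conditions* are that $f_i$ is weakly decreasing in $x_j$, for $i\ne j$. A point $\mathbf z\in[\mathbf a,\mathbf b]$ is an *$\varepsilon$-root* of $\mathbf f$ if $|\mathbf f(\mathbf z)|\le\varepsilon$. An *algorithm* is deterministic and accesses $\mathbf f$ only by adaptively evaluating it at points of the box; after finitely many evaluations it outputs a point of the box. **Proposition.**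 There are absolute constants $c,K>0$ such that for every $d\ge 3$ there is a set $S$ of exactly $d^2-d-2$ pairs $(i,j)$ with $i\neq j$ for which the following holds. For every box $[\mathbf a,\mathbf b]\subset\mathbb R^d$ with all side lengths at least $s>0$ and all $L,\varepsilon>0$ with $sL/\varepsilon\ge K$, let $\mathcal F$ be the class of all $L$-Lipschitz positive-switching functions on $[\mathbf a,\mathbf b]$ that satisfy all $d$ diagonal conditions and the $d^2-d-2$ ex-diagonal conditions indexed by $S$ ($d^2-2$ monotonicity conditions in total). Then every algorithm that finds an $\varepsilon$-root of every $\mathbf f\in\mathcal F$ makes at least $c\,sL/\varepsilon$ evaluations on some $\mathbf f\in\mathcal F$. In particular, on any fixed box, $\Omega(L/\varepsilon)$ evaluations are needed in the worst case. -/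

import Mathlib

namespace RootFinding

/-- What an algorithm does next: evaluate the unknown function at a point, or stop with an output. -/
inductive Action (X : Type*) where
  | query (x : X) : Action X
  | output (z : X) : Action X

/-- A deterministic adaptive algorithm with an evaluation oracle for an unknown function `X → Y`:
the next action is an arbitrary function of the list of all evaluations made so far. -/
def Algorithm (X Y : Type*) : Type _ := List (X × Y) → Action X

/-- `A.Runs f h n z`: started from the history `h` and with the oracle `f`, the algorithm `A` makes
exactly `n` further evaluations of `f`, then stops with the output `z`. -/
inductive Algorithm.Runs {X Y : Type*} (A : Algorithm X Y) (f : X → Y) :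
    List (X × Y) → ℕ → X → Prop where
  | output {h : List (X × Y)} {z : X} : A h = Action.output z → Algorithm.Runs A f h 0 z
  | query {h : List (X × Y)} {x : X} {n : ℕ} {z : X} : A h = Action.query x →
      Algorithm.Runs A f (h ++ [(x, f x)]) n z → Algorithm.Runs A f h (n + 1) z

/-- On the oracle `f`, the algorithm `A` makes exactly `n` evaluations and then outputs `z`. -/
def Algorithm.HaltsWith {X Y : Type*} (A : Algorithm X Y) (f : X → Y) (n : ℕ) (z : X) : Prop :=
  A.Runs f [] n z

variable {d : ℕ} {a b : Fin d → ℝ}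

/-- `f` is Lipschitz-continuous with constant `L`, for the maximum norm on both sides. -/
def IsLipschitz (L : ℝ) (f : Set.Icc a b → (Fin d → ℝ)) : Prop :=
  ∀ x y : Set.Icc a b, ‖f x - f y‖ ≤ L * ‖x.1 - y.1‖

/-- Each component `f i` is `≤ 0` on the face `x i = a i` and `≥ 0` on the face `x i = b i`. -/
def PositiveSwitching (f : Set.Icc a b → (Fin d → ℝ)) : Prop :=
  ∀ (i : Fin d) (x : Set.Icc a b), (x.1 i = a i → f x i ≤ 0) ∧ (x.1 i = b i → 0 ≤ f x i)

/-- The component `f i` is weakly increasing with the variable `x j`, all others being fixed. -/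
def IncreasingWith (f : Set.Icc a b → (Fin d → ℝ)) (i j : Fin d) : Prop :=
  ∀ x y : Set.Icc a b, (∀ k, k ≠ j → x.1 k = y.1 k) → x.1 j ≤ y.1 j → f x i ≤ f y i

/-- The component `f i` is weakly decreasing with the variable `x j`, all others being fixed. -/
def DecreasingWith (f : Set.Icc a b → (Fin d → ℝ)) (i j : Fin d) : Prop :=
  ∀ x y : Set.Icc a b, (∀ k, k ≠ j → x.1 k = y.1 k) → x.1 j ≤ y.1 j → f y i ≤ f x i

/-- `z` is an `ε`-root of `f`, for the maximum norm. -/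
def IsApproxRoot (ε : ℝ) (f : Set.Icc a b → (Fin d → ℝ)) (z : Set.Icc a b) : Prop :=
  ‖f z‖ ≤ ε

/-- The `L`-Lipschitz positive-switching functions on the box `[a, b]` that satisfy all `d`
diagonal conditions and the ex-diagonal conditions `f i` decreasing with `x j`, `(i, j) ∈ S`. -/
def MonotoneSwitchingClass (a b : Fin d → ℝ) (L : ℝ) (S : Finset (Fin d × Fin d)) :
    Set (Set.Icc a b → (Fin d → ℝ)) :=
  {f | IsLipschitz L f ∧ PositiveSwitching f ∧ (∀ i, IncreasingWith f i i) ∧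
    ∀ p ∈ S, DecreasingWith f p.1 p.2}

/-- For every function of the class `F`, the algorithm stops after finitely many evaluations and
outputs an `ε`-root. -/
def Algorithm.FindsApproxRoots (A : Algorithm (Set.Icc a b) (Fin d → ℝ)) (ε : ℝ)
    (F : Set (Set.Icc a b → (Fin d → ℝ))) : Prop :=
  ∀ f ∈ F, ∃ n z, A.HaltsWith f n z ∧ IsApproxRoot ε f z

end RootFinding

/-! An adversary hides a lattice path in a square of side `m`, of order `s * L / ε`. The path rises
from the bottom side. A plane field points down on the path, outwards on its two flanks and up
elsewhere. Where the path separates the flanks, opposite directions are never adjacent, so the field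
is small only near the row where the path ends (`LatticePath.Valid.half_le`). While no query meets
the strip of height 4 around that row, no queried point is an approximate root. When a query does
meet it, the path is prolonged: along its end row to a column far from all earlier queries, then up
to the lowest strip without queries. Earlier answers do not change (`LatticePath.turn_field_eq`).
Each query spoils at most one strip of rows and one of columns, so about `m / 4` queries can be
answered (`Explained.step`).

A third variable `z` makes the field monotone (`lift_mem_class`). Both plane components receive the
term `2 (x + y - 2 z)`: its diagonal slope 2 outweighs the 2-Lipschitz field, and it decreases in
`z`. The third component `2 (2 z - x - y)` is monotone as required and makes that term small at any
approximate root. Only the dependence of each plane component on the other plane variable is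
uncontrolled, which costs the two conditions left out of `S`. -/

namespace RootFinding

/-! ### Adversary arguments for adaptive algorithms -/

section Adversary

variable {X Y : Type*}

/-- Adversary argument: if every history with the invariant `Inv` can be extended after any query,
and is explained by a function of `F` for which no queried point is good, then an algorithm that
always outputs good points needs at least `n` evaluations on some function of `F`. -/
theorem Algorithm.exists_le_evaluations (A : Algorithm X Y) (F : Set (X → Y))
    (good : (X → Y) → X → Prop) (Inv : List (X × Y) → Prop) (n : ℕ) (h_nil : Inv [])
    (h_step : ∀ h, h.length ≤ n → Inv h → ∀ x, ∃ y, Inv (h ++ [(x, y)]))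
    (h_fun : ∀ h, Inv h → ∃ f ∈ F, ∀ p ∈ h, f p.1 = p.2 ∧ ¬ good f p.1)
    (hA : ∀ f ∈ F, ∃ k z, A.HaltsWith f k z ∧ good f z) :
    ∃ f ∈ F, ∃ k z, A.HaltsWith f k z ∧ n ≤ k := by
  have key : ∀ k ≤ n, ∃ h : List (X × Y), h.length = k ∧ Inv h ∧
      ∀ f : X → Y, (∀ p ∈ h, f p.1 = p.2) → ∀ l z, A.HaltsWith f l z →
        ∃ l', l = k + l' ∧ A.Runs f h l' z := by
    intro k
    induction k with
    | zero => exact fun _ => ⟨[], rfl, h_nil, fun f _ l z hl => ⟨l, by simp, hl⟩⟩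
    | succ k ih =>
      intro hk
      obtain ⟨h, hlen, hinv, hrun⟩ := ih (by omega)
      cases hact : A h with
      | output z =>
        exfalso
        -- The output is treated as one more query: some function consistent with the history then
        -- makes it a bad point.
        obtain ⟨y, hy⟩ := h_step h (by omega) hinv z
        obtain ⟨f, hf, hcons⟩ := h_fun _ hy
        obtain ⟨l, z', hl, hz'⟩ := hA f hf
        obtain ⟨l', -, hl'⟩ := hrun f (fun p hp => (hcons p (by simp [hp])).1) l z' hl
        cases hl' with
        | output ho =>
          rw [hact] at ho
          cases ho
          exact (hcons (z, y) (by simp)).2 hz'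
        | query hq _ => rw [hact] at hq; cases hq
      | query x =>
        obtain ⟨y, hy⟩ := h_step h (by omega) hinv x
        refine ⟨h ++ [(x, y)], by simp [hlen], hy, fun f hf l z hl => ?_⟩
        obtain ⟨l', hll, hl'⟩ := hrun f (fun p hp => hf p (by simp [hp])) l z hl
        have hfx : f x = y := hf (x, y) (by simp)
        cases hl' with
        | output ho => rw [hact] at ho; cases ho
        | @query _ x' l'' _ hq hr =>
          rw [hact] at hq
          cases hq
          rw [hfx] at hr
          exact ⟨l'', by omega, hr⟩
  obtain ⟨h, -, hinv, hrun⟩ := key n le_rfl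
  obtain ⟨f, hf, hcons⟩ := h_fun h hinv
  obtain ⟨k, z, hk, -⟩ := hA f hf
  obtain ⟨l', hl, -⟩ := hrun f (fun p hp => (hcons p hp).1) k z hk
  exact ⟨f, hf, k, z, hk, by omega⟩

end Adversary

/-! ### Interpolation of lattice labels by tents -/

section Bump

/-- A lattice point as a point of the plane, which carries the maximum metric. -/
def node (v : ℤ × ℤ) : ℝ × ℝ := ((v.1 : ℝ), (v.2 : ℝ))

/-- The supremum of the unit tents centred at the lattice points of `S`. -/
noncomputable def bump (S : Set (ℤ × ℤ)) (p : ℝ × ℝ) : ℝ :=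
  ⨆ v : S, max 0 (1 - dist p (node v))

theorem dist_node_lt_iff {p : ℝ × ℝ} {v : ℤ × ℤ} {r : ℝ} :
    dist p (node v) < r ↔ |p.1 - v.1| < r ∧ |p.2 - v.2| < r := by
  rw [Prod.dist_eq, max_lt_iff, Real.dist_eq, Real.dist_eq]; rfl

theorem bump_nonneg (S : Set (ℤ × ℤ)) (p : ℝ × ℝ) : 0 ≤ bump S p :=
  Real.iSup_nonneg fun _ => le_max_left _ _

theorem tent_le_bump {S : Set (ℤ × ℤ)} {v : ℤ × ℤ} (hv : v ∈ S) (p : ℝ × ℝ) :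
    max 0 (1 - dist p (node v)) ≤ bump S p := by
  refine le_ciSup (f := fun v : S => max 0 (1 - dist p (node v))) ⟨1, ?_⟩ ⟨v, hv⟩
  rintro _ ⟨w, rfl⟩
  exact max_le zero_le_one (by linarith [dist_nonneg (x := p) (y := node w)])

theorem bump_eq_zero {S : Set (ℤ × ℤ)} {p : ℝ × ℝ} (h : ∀ v ∈ S, ¬ dist p (node v) < 1) :
    bump S p = 0 :=
  le_antisymm (Real.iSup_le (fun v => max_le le_rfl (by linarith [not_lt.1 (h v v.2)])) le_rfl)
    (bump_nonneg S p)

theorem bump_le_add_dist (S : Set (ℤ × ℤ)) (p q : ℝ × ℝ) : bump S p ≤ bump S q + dist p q := by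
  refine Real.iSup_le (fun v => ?_) (add_nonneg (bump_nonneg S q) dist_nonneg)
  have h := tent_le_bump v.2 q
  have h' := dist_triangle q p (node v)
  rw [dist_comm q p] at h'
  exact max_le (add_nonneg (bump_nonneg S q) dist_nonneg)
    (by linarith [le_max_right 0 (1 - dist q (node v))])

theorem bump_mono_of_local {S T : Set (ℤ × ℤ)} {p : ℝ × ℝ}
    (h : ∀ v, dist p (node v) < 1 → v ∈ S → v ∈ T) : bump S p ≤ bump T p := by
  refine Real.iSup_le (fun v => ?_) (bump_nonneg T p)
  by_cases hv : dist p (node v) < 1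
  · exact tent_le_bump (h v hv v.2) p
  · exact max_le (bump_nonneg T p) (by linarith [not_lt.1 hv, bump_nonneg T p])

theorem bump_congr_of_local {S T : Set (ℤ × ℤ)} {p : ℝ × ℝ}
    (h : ∀ v, dist p (node v) < 1 → (v ∈ S ↔ v ∈ T)) : bump S p = bump T p :=
  le_antisymm (bump_mono_of_local fun v hv => (h v hv).1)
    (bump_mono_of_local fun v hv => (h v hv).2)

theorem abs_bump_sub_bump_le (S T : Set (ℤ × ℤ)) (p q : ℝ × ℝ) :
    |(bump S p - bump T p) - (bump S q - bump T q)| ≤ 2 * dist p q := by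
  have h1 := bump_le_add_dist S p q
  have h2 := bump_le_add_dist S q p
  have h3 := bump_le_add_dist T p q
  have h4 := bump_le_add_dist T q p
  rw [dist_comm q p] at h2 h4
  rw [abs_le]
  constructor <;> linarith

/-- If the label of a lattice point close to `p` has no opposite label among the neighbours, the
difference of the two bumps is far from zero. -/
theorem half_le_bump_sub {S T : Set (ℤ × ℤ)} {p : ℝ × ℝ} {v : ℤ × ℤ}
    (hv : dist p (node v) ≤ 1 / 2) (hS : v ∈ S) (hT : ∀ w ∈ T, ¬ dist p (node w) < 1) :
    1 / 2 ≤ bump S p - bump T p := by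
  rw [bump_eq_zero hT]
  have := tent_le_bump hS p
  linarith [le_max_right 0 (1 - dist p (node v))]

theorem exists_node_dist_le (p : ℝ × ℝ) : ∃ v, dist p (node v) ≤ 1 / 2 := by
  refine ⟨(round p.1, round p.2), ?_⟩
  rw [Prod.dist_eq, Real.dist_eq, Real.dist_eq]
  exact max_le (abs_sub_round p.1) (abs_sub_round p.2)

end Bump

/-! ### Lattice paths and the field rotating around them -/

/-- A lattice path going upwards: it occupies the interval `[lo j, hi j]` of each row `j < top`. -/
structure LatticePath where
  lo : ℤ → ℤ
  hi : ℤ → ℤ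
  top : ℤ

namespace LatticePath

/-- Two lattice points that agree or are neighbours, possibly diagonally. -/
def Near (v w : ℤ × ℤ) : Prop := |v.1 - w.1| ≤ 1 ∧ |v.2 - w.2| ≤ 1

theorem near_of_dist {p : ℝ × ℝ} {v w : ℤ × ℤ} (hv : dist p (node v) ≤ 1 / 2)
    (hw : dist p (node w) < 1) : Near v w := by
  rw [dist_node_lt_iff] at hw
  rw [Prod.dist_eq, max_le_iff, Real.dist_eq, Real.dist_eq] at hv
  obtain ⟨h1, h2⟩ := hv
  obtain ⟨h3, h4⟩ := hw
  simp only [node] at h1 h2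
  have aux : ∀ (t : ℝ) (i j : ℤ), |t - i| ≤ 1 / 2 → |t - j| < 1 → |i - j| ≤ 1 := by
    intro t i j hi hj
    rw [abs_le] at hi
    rw [abs_lt] at hj
    have h5 : (i : ℝ) < j + 2 := by linarith
    have h6 : (j : ℝ) < i + 2 := by linarith
    have h5' : i < j + 2 := by exact_mod_cast h5
    have h6' : j < i + 2 := by exact_mod_cast h6
    rw [abs_le]
    omega
  exact ⟨aux _ _ _ h1 h3, aux _ _ _ h2 h4⟩

variable (P : LatticePath)

/-- The lattice points on the path. -/
def down : Set (ℤ × ℤ) := {v | v.2 < P.top ∧ P.lo v.2 ≤ v.1 ∧ v.1 ≤ P.hi v.2}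

/-- The lattice points on the path or next to it. -/
def collar : Set (ℤ × ℤ) := {v | ∃ w ∈ P.down, Near v w}

/-- The lattice points away from the path. -/
def up : Set (ℤ × ℤ) := P.collarᶜ

/-- The lattice points next to the path, on its left. -/
def left : Set (ℤ × ℤ) := {v | v ∈ P.collar ∧ v ∉ P.down ∧ v.1 < P.lo v.2}

/-- The lattice points next to the path, on its right or at its end. -/
def right : Set (ℤ × ℤ) := {v | v ∈ P.collar ∧ v ∉ P.down ∧ P.lo v.2 ≤ v.1}

/-- Horizontal component of the plane vector field that rotates around the path. -/
noncomputable def horizontal (p : ℝ × ℝ) : ℝ := bump P.right p - bump P.left p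

/-- Vertical component of the plane vector field that rotates around the path. -/
noncomputable def vertical (p : ℝ × ℝ) : ℝ := bump P.up p - bump P.down p

/-- The path is connected, starts from a bottom row that it fills, and keeps away from the other
sides of the square `[0, m] × [0, m]`. -/
structure Valid (m : ℕ) : Prop where
  lo_le_hi : ∀ j, P.lo j ≤ P.hi j
  lo_le_hi_succ : ∀ j, P.lo j ≤ P.hi (j + 1)
  lo_succ_le_hi : ∀ j, P.lo (j + 1) ≤ P.hi j
  lo_zero : P.lo 0 ≤ 0
  hi_zero : m ≤ P.hi 0
  two_le_lo : ∀ j, 1 ≤ j → 2 ≤ P.lo j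
  hi_le : ∀ j, 1 ≤ j → P.hi j ≤ m - 2
  top_pos : 1 ≤ P.top
  top_lt : P.top ≤ m - 1

variable {P}

theorem near_symm {v w : ℤ × ℤ} (h : Near v w) : Near w v := by
  unfold Near at *
  rwa [abs_sub_comm, abs_sub_comm w.2]

variable {m : ℕ}

/-- Below the end row, the intervals of equal or consecutive rows overlap, so a point left of one
and a point right of the other have columns differing by at least 2. -/
theorem Valid.row_eq_top (hP : P.Valid m) {v w : ℤ × ℤ} (hv : v ∈ P.left) (hw : w ∈ P.right)
    (hvw : Near v w) : w.2 = P.top := by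
  obtain ⟨-, -, hvl⟩ := hv
  obtain ⟨⟨u, hu, hwu⟩, hwd, hwl⟩ := hw
  unfold Near at hwu hvw
  obtain ⟨h1, h2⟩ := hvw
  obtain ⟨-, h3⟩ := hwu
  have hu' : u.2 < P.top := hu.1
  rw [abs_le] at h1 h2 h3
  by_contra hne
  have hlt : w.2 < P.top := by omega
  have hhi : P.hi w.2 < w.1 := by
    by_contra hcon
    exact hwd ⟨hlt, hwl, not_lt.1 hcon⟩
  rcases (by omega : v.2 = w.2 ∨ v.2 + 1 = w.2 ∨ v.2 = w.2 + 1) with h | h | h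
  · have := hP.lo_le_hi w.2
    rw [h] at hvl
    omega
  · have := hP.lo_le_hi_succ v.2
    rw [h] at this
    omega
  · have := hP.lo_succ_le_hi w.2
    rw [h] at hvl
    omega

/-- The plane field is far from zero away from the row where the path ends. -/
theorem Valid.half_le (hP : P.Valid m) {p : ℝ × ℝ} (hp : 2 ≤ |p.2 - P.top|) :
    1 / 2 ≤ |P.horizontal p| ∨ 1 / 2 ≤ |P.vertical p| := by
  obtain ⟨v, hv⟩ := exists_node_dist_le p
  -- Only tents centred at distance less than 1 contribute at `p`, and none of these centres lies in
  -- the end row.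
  have hrow : ∀ w : ℤ × ℤ, dist p (node w) < 1 → w.2 ≠ P.top := by
    intro w hw he
    have := (dist_node_lt_iff.1 hw).2
    rw [he] at this
    linarith
  have hv1 : dist p (node v) < 1 := by linarith
  by_cases hvc : v ∈ P.collar
  · by_cases hvd : v ∈ P.down
    · right
      have := half_le_bump_sub (T := P.up) hv hvd
        (fun w hw hd => hw ⟨v, hvd, near_symm (near_of_dist hv hd)⟩)
      rw [vertical, abs_sub_comm]
      exact this.trans (le_abs_self _)
    · left
      rcases lt_or_ge v.1 (P.lo v.2) with hl | hl
      · have hvL : v ∈ P.left := ⟨hvc, hvd, hl⟩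
        have := half_le_bump_sub (T := P.right) hv hvL
          (fun w hw hd => hrow w hd (hP.row_eq_top hvL hw (near_of_dist hv hd)))
        rw [horizontal, abs_sub_comm]
        exact this.trans (le_abs_self _)
      · have hvR : v ∈ P.right := ⟨hvc, hvd, hl⟩
        have := half_le_bump_sub (T := P.left) hv hvR
          (fun w hw hd => hrow v hv1 (hP.row_eq_top hw hvR (near_symm (near_of_dist hv hd))))
        exact this.trans (le_abs_self _)
  · right
    have := half_le_bump_sub (S := P.up) (T := P.down) hv hvc
      (fun w hw hd => hvc ⟨w, hw, near_of_dist hv hd⟩)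
    exact this.trans (le_abs_self _)

/-! ### Signs of the field near the sides of the square -/

theorem node_bounds {p : ℝ × ℝ} {v : ℤ × ℤ} (hp1 : p.1 ∈ Set.Icc (0 : ℝ) m)
    (hp2 : p.2 ∈ Set.Icc (0 : ℝ) m) (hv : dist p (node v) < 1) :
    0 ≤ v.1 ∧ v.1 ≤ m ∧ 0 ≤ v.2 ∧ v.2 ≤ m := by
  obtain ⟨h1, h2⟩ := dist_node_lt_iff.1 hv
  rw [abs_lt] at h1 h2
  obtain ⟨h3, h4⟩ := hp1
  obtain ⟨h5, h6⟩ := hp2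
  have a1 : (-1 : ℝ) < v.1 := by linarith
  have a2 : (v.1 : ℝ) < m + 1 := by linarith
  have a3 : (-1 : ℝ) < v.2 := by linarith
  have a4 : (v.2 : ℝ) < m + 1 := by linarith
  have b1 : -1 < v.1 := by exact_mod_cast a1
  have b2 : v.1 < m + 1 := by exact_mod_cast a2
  have b3 : -1 < v.2 := by exact_mod_cast a3
  have b4 : v.2 < m + 1 := by exact_mod_cast a4
  omega

theorem Valid.mem_down_of_row_zero (hP : P.Valid m) {v : ℤ × ℤ} (h0 : 0 ≤ v.1) (hm : v.1 ≤ m)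
    (hv : v.2 = 0) : v ∈ P.down := by
  have h1 := hP.lo_zero
  have h2 := hP.hi_zero
  have h3 := hP.top_pos
  refine ⟨by omega, ?_, ?_⟩ <;> rw [hv] <;> omega

theorem Valid.horizontal_nonpos (hP : P.Valid m) {p : ℝ × ℝ} (hp1 : p.1 ∈ Set.Icc (0 : ℝ) m)
    (hp2 : p.2 ∈ Set.Icc (0 : ℝ) m) (hp : p.1 < 1) : P.horizontal p ≤ 0 := by
  have : bump P.right p = 0 := by
    refine bump_eq_zero fun v hv hd => ?_
    obtain ⟨h1, h2, h3, -⟩ := node_bounds hp1 hp2 hd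
    have h4 := (abs_lt.1 (dist_node_lt_iff.1 hd).1).1
    have h5 : (v.1 : ℝ) < 2 := by linarith
    have h6 : v.1 < 2 := by exact_mod_cast h5
    obtain ⟨-, hvd, hvl⟩ := hv
    rcases h3.eq_or_lt with h | h
    · exact hvd (hP.mem_down_of_row_zero h1 h2 h.symm)
    · have := hP.two_le_lo v.2 h
      omega
  rw [horizontal, this]
  linarith [bump_nonneg P.left p]

theorem Valid.horizontal_nonneg (hP : P.Valid m) {p : ℝ × ℝ} (hp1 : p.1 ∈ Set.Icc (0 : ℝ) m)
    (hp2 : p.2 ∈ Set.Icc (0 : ℝ) m) (hp : m - 1 < p.1) : 0 ≤ P.horizontal p := by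
  have : bump P.left p = 0 := by
    refine bump_eq_zero fun v hv hd => ?_
    obtain ⟨h1, h2, h3, -⟩ := node_bounds hp1 hp2 hd
    have h4 := (abs_lt.1 (dist_node_lt_iff.1 hd).1).2
    have h5 : (m : ℝ) < v.1 + 2 := by linarith
    have h6 : m < v.1 + 2 := by exact_mod_cast h5
    obtain ⟨-, hvd, hvl⟩ := hv
    rcases h3.eq_or_lt with h | h
    · exact hvd (hP.mem_down_of_row_zero h1 h2 h.symm)
    · have := hP.hi_le v.2 h
      have := hP.lo_le_hi v.2
      omega
  rw [horizontal, this]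
  linarith [bump_nonneg P.right p]

theorem Valid.vertical_nonpos (hP : P.Valid m) {p : ℝ × ℝ} (hp1 : p.1 ∈ Set.Icc (0 : ℝ) m)
    (hp2 : p.2 ∈ Set.Icc (0 : ℝ) m) (hp : p.2 < 1) : P.vertical p ≤ 0 := by
  have : bump P.up p = 0 := by
    refine bump_eq_zero fun v hv hd => hv ?_
    obtain ⟨h1, h2, h3, -⟩ := node_bounds hp1 hp2 hd
    have h4 := (abs_lt.1 (dist_node_lt_iff.1 hd).2).1
    have h5 : (v.2 : ℝ) < 2 := by linarith
    have h6 : v.2 < 2 := by exact_mod_cast h5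
    refine ⟨(v.1, 0), hP.mem_down_of_row_zero h1 h2 rfl, by simp, ?_⟩
    rw [abs_le]
    simp only
    omega
  rw [vertical, this]
  linarith [bump_nonneg P.down p]

theorem Valid.vertical_nonneg (hP : P.Valid m) {p : ℝ × ℝ} (hp : m - 1 < p.2) :
    0 ≤ P.vertical p := by
  have : bump P.down p = 0 := by
    refine bump_eq_zero fun v hv hd => ?_
    have h4 := (abs_lt.1 (dist_node_lt_iff.1 hd).2).2
    have h5 : (m : ℝ) < v.2 + 2 := by linarith
    have h6 : m < v.2 + 2 := by exact_mod_cast h5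
    have := hP.top_lt
    have := hv.1
    omega
  rw [vertical, this]
  linarith [bump_nonneg P.up p]

/-! ### Prolonging a path -/

/-- Prolong a path by a turn in the row `top` to the column `c`, followed by a vertical piece. -/
def turn (P : LatticePath) (c top' : ℤ) : LatticePath where
  lo j := if j < P.top then P.lo j else if j = P.top then min (P.lo P.top) c else c
  hi j := if j < P.top then P.hi j else if j = P.top then max (P.hi P.top) c else c
  top := top'

theorem Valid.turn (hP : P.Valid m) {c t : ℤ} (hc : 2 ≤ c) (hcm : c ≤ m - 2) (ht : P.top < t)
    (htm : t ≤ m - 1) : (P.turn c t).Valid m := by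
  have h1 := hP.lo_le_hi
  have h2 := hP.lo_le_hi_succ
  have h3 := hP.lo_succ_le_hi
  have h4 := hP.top_pos
  have h5 := hP.two_le_lo
  have h6 := hP.hi_le
  have key : ∀ j, j + 1 = P.top ∨ j + 1 < P.top ∨ j = P.top ∨ P.top < j := by
    intro j; omega
  constructor
  · intro j
    have := h1 j
    have := h1 P.top
    simp only [LatticePath.turn]
    split_ifs <;> omega
  · intro j
    have := h2 j
    simp only [LatticePath.turn]
    rcases key j with h | h | h | h
    · rw [h] at this; split_ifs <;> omega
    · split_ifs <;> omega
    · split_ifs <;> omega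
    · split_ifs <;> omega
  · intro j
    have := h3 j
    simp only [LatticePath.turn]
    rcases key j with h | h | h | h
    · rw [h] at this; split_ifs <;> omega
    · split_ifs <;> omega
    · split_ifs <;> omega
    · split_ifs <;> omega
  · simpa [LatticePath.turn, show (0 : ℤ) < P.top by omega] using hP.lo_zero
  · simpa [LatticePath.turn, show (0 : ℤ) < P.top by omega] using hP.hi_zero
  · intro j hj
    have := h5 j hj
    have := h5 P.top h4
    simp only [LatticePath.turn]
    split_ifs <;> omega
  · intro j hj
    have := h6 j hj
    have := h6 P.top h4
    simp only [LatticePath.turn]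
    split_ifs <;> omega
  · simp only [LatticePath.turn]; omega
  · exact htm

theorem mem_down_turn_iff {c t : ℤ} (ht : P.top < t) {v : ℤ × ℤ} (hv1 : v.1 ≠ c)
    (hv2 : v.2 ≠ P.top) : v ∈ (P.turn c t).down ↔ v ∈ P.down := by
  simp only [down, LatticePath.turn, Set.mem_ofPred_eq]
  split_ifs <;> omega

/-- A label depends on the path within distance 1 only, hence the margins. The last clause needs the
collar: `lo` does change above the old end row, but a collar point outside the rows next to that row
lies below it. -/
theorem turn_labels {c t : ℤ} (ht : P.top < t) {v : ℤ × ℤ} (hv1 : 1 < |v.1 - c|)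
    (hv2 : 1 < |v.2 - P.top|) :
    (v ∈ (P.turn c t).down ↔ v ∈ P.down) ∧ (v ∈ (P.turn c t).collar ↔ v ∈ P.collar) ∧
      (v ∈ P.collar → (P.turn c t).lo v.2 = P.lo v.2) := by
  have hne : ∀ w, Near v w → (w ∈ (P.turn c t).down ↔ w ∈ P.down) := by
    rintro w ⟨h1, h2⟩
    exact mem_down_turn_iff ht (fun h => by rw [h] at h1; omega)
      (fun h => by rw [h] at h2; omega)
  refine ⟨hne v (by simp [Near]), ?_, ?_⟩
  · exact ⟨fun ⟨w, hw, hn⟩ => ⟨w, (hne w hn).1 hw, hn⟩,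
      fun ⟨w, hw, hn⟩ => ⟨w, (hne w hn).2 hw, hn⟩⟩
  · rintro ⟨w, hw, -, h2⟩
    have hw1 : w.2 < P.top := hw.1
    rw [abs_le] at h2
    rw [lt_abs] at hv2
    have : v.2 < P.top := by omega
    simp [LatticePath.turn, this]

theorem one_lt_abs_sub {t : ℝ} {i k : ℤ} (h : 2 ≤ |t - k|) (hi : |t - i| < 1) : 1 < |i - k| := by
  have h1 : (1 : ℝ) < |(i : ℝ) - k| := by
    have := abs_sub_le t (i : ℝ) (k : ℝ)
    linarith
  exact_mod_cast h1

/-- A turn is invisible away from the row of the turn and the new column. -/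
theorem turn_field_eq {c t : ℤ} (ht : P.top < t) {p : ℝ × ℝ} (hp1 : 2 ≤ |p.1 - c|)
    (hp2 : 2 ≤ |p.2 - P.top|) :
    (P.turn c t).horizontal p = P.horizontal p ∧ (P.turn c t).vertical p = P.vertical p := by
  have key := fun (v : ℤ × ℤ) (hv : dist p (node v) < 1) =>
    turn_labels (P := P) (v := v) ht (one_lt_abs_sub hp1 (dist_node_lt_iff.1 hv).1)
      (one_lt_abs_sub hp2 (dist_node_lt_iff.1 hv).2)
  constructor
  · refine congrArg₂ (· - ·) (bump_congr_of_local fun v hv => ?_)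
      (bump_congr_of_local fun v hv => ?_)
    · obtain ⟨h1, h2, h3⟩ := key v hv
      simp only [right, Set.mem_ofPred_eq, h1, h2]
      exact and_congr_right fun h => by rw [h3 h]
    · obtain ⟨h1, h2, h3⟩ := key v hv
      simp only [left, Set.mem_ofPred_eq, h1, h2]
      exact and_congr_right fun h => by rw [h3 h]
  · exact congrArg₂ (· - ·) (bump_congr_of_local fun v hv => not_congr (key v hv).2.1)
      (bump_congr_of_local fun v hv => (key v hv).1)

/-- The path that climbs from the bottom row to the fourth row. -/
def initial (m : ℕ) : LatticePath where
  lo j := if j ≤ 0 then 0 else 4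
  hi j := if j ≤ 0 then m else 4
  top := 4

theorem initial_valid (hm : 6 ≤ m) : (initial m).Valid m := by
  constructor <;> simp only [initial] <;> intros <;> (try split_ifs) <;> omega

end LatticePath

/-! ### From the plane field to monotone functions on the box -/

section Lift

variable {d : ℕ} {a b : Fin d → ℝ}

/-- The coordinate `x i`, rescaled affinely from `[a i, b i]` to `[0, m]`. -/
noncomputable def scaled (m : ℕ) (x : Set.Icc a b) (i : Fin d) : ℝ :=
  m * ((x.1 i - a i) / (b i - a i))

/-- A component of the lifted field: `g + 2 (x + y - 2 z)`, clamped between two increasing affine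
functions of `x` that enforce the switching conditions at `x = 0` and `x = m`. -/
noncomputable def clamped (m g x y z : ℝ) : ℝ :=
  max (10 * (x - m)) (min (10 * x) (g + 2 * (x + y - 2 * z)))

/-- The functions on the box obtained from a plane vector field `G`: the third component vanishes
where the third coordinate is the mean of the first two, and there the first two give `G`. -/
noncomputable def lift (ε : ℝ) (m : ℕ) (i₀ i₁ i₂ : Fin d) (G : ℝ × ℝ → ℝ × ℝ)
    (x : Set.Icc a b) (i : Fin d) : ℝ :=
  let X := scaled m x
  5 * ε * if i = i₀ then clamped m (G (X i₀, X i₁)).1 (X i₀) (X i₁) (X i₂)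
    else if i = i₁ then clamped m (G (X i₀, X i₁)).2 (X i₁) (X i₀) (X i₂)
    else if i = i₂ then 2 * (2 * X i₂ - X i₀ - X i₁) else 0

theorem scaled_mem {s : ℝ} (hs : 0 < s) (hab : ∀ i, s ≤ b i - a i) (m : ℕ) (x : Set.Icc a b)
    (i : Fin d) : scaled m x i ∈ Set.Icc (0 : ℝ) m := by
  have h1 := x.2.1 i
  have h2 := x.2.2 i
  have h3 : 0 < b i - a i := hs.trans_le (hab i)
  have h4 : (0 : ℝ) ≤ m := Nat.cast_nonneg m
  constructor
  · exact mul_nonneg h4 (div_nonneg (by linarith) h3.le)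
  · exact mul_le_of_le_one_right h4 ((div_le_one h3).2 (by linarith))

theorem abs_scaled_sub_le {s : ℝ} (hs : 0 < s) (hab : ∀ i, s ≤ b i - a i) (m : ℕ)
    (x y : Set.Icc a b) (i : Fin d) :
    |scaled m x i - scaled m y i| ≤ m / s * ‖x.1 - y.1‖ := by
  have h3 : 0 < b i - a i := hs.trans_le (hab i)
  have h4 : (0 : ℝ) ≤ m := Nat.cast_nonneg m
  have h5 : |x.1 i - y.1 i| ≤ ‖x.1 - y.1‖ := norm_le_pi_norm (x.1 - y.1) i
  have h6 : scaled m x i - scaled m y i = m * ((x.1 i - y.1 i) / (b i - a i)) := by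
    unfold scaled; ring
  rw [h6, abs_mul, abs_div, abs_of_pos h3, abs_of_nonneg h4, div_mul_eq_mul_div, mul_div_assoc]
  exact mul_le_mul_of_nonneg_left (div_le_div₀ (norm_nonneg _) h5 hs (hab i)) h4

theorem scaled_le_scaled {s : ℝ} (hs : 0 < s) (hab : ∀ i, s ≤ b i - a i) (m : ℕ)
    {x y : Set.Icc a b} {i : Fin d} (h : x.1 i ≤ y.1 i) : scaled m x i ≤ scaled m y i :=
  mul_le_mul_of_nonneg_left
    (div_le_div_of_nonneg_right (by linarith) (hs.trans_le (hab i)).le) (Nat.cast_nonneg m)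

theorem scaled_congr (m : ℕ) {x y : Set.Icc a b} {i : Fin d} (h : x.1 i = y.1 i) :
    scaled m x i = scaled m y i := by
  unfold scaled; rw [h]

theorem abs_clamped_sub_le {m g x y z g' x' y' z' D : ℝ} (hg : |g - g'| ≤ 2 * D)
    (hx : |x - x'| ≤ D) (hy : |y - y'| ≤ D) (hz : |z - z'| ≤ D) :
    |clamped m g x y z - clamped m g' x' y' z'| ≤ 10 * D := by
  unfold clamped
  refine (abs_max_sub_max_le_max _ _ _ _).trans (max_le ?_
    ((abs_min_sub_min_le_max _ _ _ _).trans (max_le ?_ ?_))) <;>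
  · rw [abs_le] at *
    constructor <;> linarith [hg.1, hg.2, hx.1, hx.2, hy.1, hy.2, hz.1, hz.2]

theorem clamped_mono {m g g' x x' y z z' : ℝ} (hx : x ≤ x') (h : g - g' ≤ 2 * (x' - x))
    (hz : z' ≤ z) : clamped m g x y z ≤ clamped m g' x' y z' :=
  max_le_max (by linarith) (min_le_min (by linarith) (by linarith))

variable {ε s L : ℝ} {m : ℕ} {i₀ i₁ i₂ : Fin d} {G : ℝ × ℝ → ℝ × ℝ}

/-- The factor 50 is `5 * 10`: the scale `5 * ε` times the Lipschitz constant 10 of `clamped`, whose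
inner expression has constant at most `2 + 8` and whose clamps have slope 10. -/
theorem lift_mem_class (hs : 0 < s) (hab : ∀ i, s ≤ b i - a i) (hε : 0 < ε) (h01 : i₀ ≠ i₁)
    (h02 : i₀ ≠ i₂) (h12 : i₁ ≠ i₂) (hm : 50 * ε * m ≤ s * L)
    (hG₁ : ∀ p q, |(G p).1 - (G q).1| ≤ 2 * dist p q)
    (hG₂ : ∀ p q, |(G p).2 - (G q).2| ≤ 2 * dist p q) {S : Finset (Fin d × Fin d)}
    (hS : ∀ p ∈ S, p.1 ≠ p.2 ∧ p ≠ (i₀, i₁) ∧ p ≠ (i₁, i₀)) :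
    (lift ε m i₀ i₁ i₂ G : Set.Icc a b → Fin d → ℝ) ∈ MonotoneSwitchingClass a b L S := by
  have hm0 : (0 : ℝ) ≤ m := Nat.cast_nonneg m
  have h5 : (0 : ℝ) ≤ 5 * ε := by linarith
  refine ⟨fun x y => ?_, fun i x => ?_, fun i x y hxy hi => ?_, ?_⟩
  · set D := m / s * ‖x.1 - y.1‖ with hD
    have hX := abs_scaled_sub_le hs hab m x y
    have hdist : dist (scaled m x i₀, scaled m x i₁) (scaled m y i₀, scaled m y i₁) ≤ D := by
      rw [Prod.dist_eq]
      exact max_le (hX i₀) (hX i₁)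
    have hD0 : 0 ≤ D := dist_nonneg.trans hdist
    have hL : 5 * ε * (10 * D) ≤ L * ‖x.1 - y.1‖ := by
      have : 5 * ε * (10 * D) = (50 * ε * m) / s * ‖x.1 - y.1‖ := by rw [hD]; ring
      rw [this]
      refine mul_le_mul_of_nonneg_right ?_ (norm_nonneg _)
      rw [div_le_iff₀ hs]
      linarith
    refine (pi_norm_le_iff_of_nonneg ?_).2 fun i => le_trans ?_ hL
    · exact le_trans (by positivity) hL
    · rw [Pi.sub_apply, Real.norm_eq_abs]
      simp only [lift]
      rw [← mul_sub, abs_mul, abs_of_nonneg h5]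
      refine mul_le_mul_of_nonneg_left ?_ h5
      split_ifs
      · exact abs_clamped_sub_le ((hG₁ _ _).trans (by linarith)) (hX _) (hX _) (hX _)
      · exact abs_clamped_sub_le ((hG₂ _ _).trans (by linarith)) (hX _) (hX _) (hX _)
      · have k0 := abs_le.1 (hX i₀)
        have k1 := abs_le.1 (hX i₁)
        have k2 := abs_le.1 (hX i₂)
        rw [abs_le]
        constructor <;> linarith [k0.1, k0.2, k1.1, k1.2, k2.1, k2.2]
      · simpa using hD0
  · have hX := scaled_mem hs hab m x
    have hpos : 0 < b i - a i := hs.trans_le (hab i)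
    have ha : x.1 i = a i → scaled m x i = 0 := fun h => by simp [scaled, h]
    have hb : x.1 i = b i → scaled m x i = m := fun h => by
      rw [scaled, h, div_self hpos.ne', mul_one]
    have k0 := hX i₀
    have k1 := hX i₁
    simp only [lift]
    refine ⟨fun h => mul_nonpos_of_nonneg_of_nonpos h5 ?_, fun h => mul_nonneg h5 ?_⟩
    · have := ha h
      split_ifs with g0 g1 g2
      · subst g0
        exact max_le (by linarith) ((min_le_left _ _).trans (by linarith))
      · subst g1
        exact max_le (by linarith) ((min_le_left _ _).trans (by linarith))
      · subst g2
        linarith [k0.1, k1.1]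
      · exact le_rfl
    · have := hb h
      split_ifs with g0 g1 g2
      · subst g0
        exact le_max_of_le_left (by linarith)
      · subst g1
        exact le_max_of_le_left (by linarith)
      · subst g2
        linarith [k0.2, k1.2]
      · exact le_rfl
  · have hle := scaled_le_scaled hs hab m hi
    have heq : ∀ k, k ≠ i → scaled m x k = scaled m y k := fun k hk => scaled_congr m (hxy k hk)
    simp only [lift]
    refine mul_le_mul_of_nonneg_left ?_ h5
    split_ifs with g0 g1 g2
    · subst g0
      rw [heq i₁ h01.symm, heq i₂ h02.symm]
      refine clamped_mono hle ((le_abs_self _).trans ((hG₁ _ _).trans ?_)) le_rfl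
      rw [Prod.dist_eq, dist_self, max_eq_left dist_nonneg, Real.dist_eq, abs_sub_comm,
        abs_of_nonneg (sub_nonneg.2 hle)]
    · subst g1
      rw [heq i₀ h01, heq i₂ h12.symm]
      refine clamped_mono hle ((le_abs_self _).trans ((hG₂ _ _).trans ?_)) le_rfl
      rw [Prod.dist_eq, dist_self, max_eq_right dist_nonneg, Real.dist_eq, abs_sub_comm,
        abs_of_nonneg (sub_nonneg.2 hle)]
    · subst g2
      rw [heq i₀ h02, heq i₁ h12]
      linarith
    · exact le_rfl
  · rintro ⟨i, j⟩ hp x y hxy hj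
    obtain ⟨hij, hp1, hp2⟩ := hS _ hp
    simp only at hij hxy hj
    have hle := scaled_le_scaled hs hab m hj
    have heq : ∀ k, k ≠ j → scaled m x k = scaled m y k := fun k hk => scaled_congr m (hxy k hk)
    have hmono : ∀ k, scaled m x k ≤ scaled m y k := fun k => by
      by_cases hk : k = j
      · rw [hk]; exact hle
      · exact (heq k hk).le
    simp only [lift]
    refine mul_le_mul_of_nonneg_left ?_ h5
    split_ifs with g0 g1 g2
    · subst g0
      have hj1 : i₁ ≠ j := by rintro rfl; exact hp1 rfl
      rw [heq i hij, heq i₁ hj1]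
      exact clamped_mono le_rfl (by linarith) (hmono i₂)
    · subst g1
      have hj0 : i₀ ≠ j := by rintro rfl; exact hp2 rfl
      rw [heq i hij, heq i₀ hj0]
      exact clamped_mono le_rfl (by linarith) (hmono i₂)
    · subst g2
      rw [heq i hij]
      linarith [hmono i₀, hmono i₁]
    · exact le_rfl

theorem lift_congr {G' : ℝ × ℝ → ℝ × ℝ} {x : Set.Icc a b}
    (h : G (scaled m x i₀, scaled m x i₁) = G' (scaled m x i₀, scaled m x i₁)) :
    lift ε m i₀ i₁ i₂ G x = lift ε m i₀ i₁ i₂ G' x := by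
  funext i
  simp only [lift, h]

/-- A clamp can hide a large `g` only within distance 1 of a side, and there `g` has the sign that
makes this clamp harmless. Otherwise the errors `1 / 5 + 1 / 5` add up, staying below the bound `1 /
2` of `LatticePath.Valid.half_le`. -/
theorem abs_le_of_abs_clamped_le {m g x y z : ℝ} (h : |clamped m g x y z| ≤ 1 / 5)
    (hz : |2 * (2 * z - x - y)| ≤ 1 / 5) (h0 : x < 1 → g ≤ 0)
    (h1 : m - 1 < x → 0 ≤ g) : |g| ≤ 2 / 5 := by
  unfold clamped at h
  rw [abs_le] at h hz ⊢
  obtain ⟨h3, h4⟩ := h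
  constructor
  · by_contra hcon
    have hg : g < 0 := by linarith
    have hx : x ≤ m - 1 := by
      by_contra hx
      linarith [h1 (not_le.1 hx)]
    have := min_le_right (10 * x) (g + 2 * (x + y - 2 * z))
    have := max_lt (show 10 * (x - m) < -(1 / 5) by linarith)
      (show min (10 * x) (g + 2 * (x + y - 2 * z)) < -(1 / 5) by linarith [hz.1, hz.2])
    linarith
  · by_contra hcon
    have hx : 1 ≤ x := by
      by_contra hx
      linarith [h0 (not_le.1 hx)]
    have := lt_min (show 1 / 5 < 10 * x by linarith)
      (show 1 / 5 < g + 2 * (x + y - 2 * z) by linarith [hz.1, hz.2])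
    have := le_max_right (10 * (x - m)) (min (10 * x) (g + 2 * (x + y - 2 * z)))
    linarith

/-- The function on the box that hides the path `P`. -/
noncomputable def hidingField (ε : ℝ) (m : ℕ) (i₀ i₁ i₂ : Fin d) (P : LatticePath) :
    Set.Icc a b → Fin d → ℝ :=
  lift ε m i₀ i₁ i₂ fun p => (P.horizontal p, P.vertical p)

theorem hidingField_mem_class (hs : 0 < s) (hab : ∀ i, s ≤ b i - a i) (hε : 0 < ε) (h01 : i₀ ≠ i₁)
    (h02 : i₀ ≠ i₂) (h12 : i₁ ≠ i₂) (hm : 50 * ε * m ≤ s * L) {S : Finset (Fin d × Fin d)}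
    (hS : ∀ p ∈ S, p.1 ≠ p.2 ∧ p ≠ (i₀, i₁) ∧ p ≠ (i₁, i₀)) (P : LatticePath) :
    (hidingField ε m i₀ i₁ i₂ P : Set.Icc a b → Fin d → ℝ) ∈ MonotoneSwitchingClass a b L S :=
  lift_mem_class hs hab hε h01 h02 h12 hm (abs_bump_sub_bump_le _ _) (abs_bump_sub_bump_le _ _) hS

theorem not_isApproxRoot_hidingField (hs : 0 < s) (hab : ∀ i, s ≤ b i - a i) (hε : 0 < ε)
    (h01 : i₀ ≠ i₁) (h02 : i₀ ≠ i₂) (h12 : i₁ ≠ i₂) {P : LatticePath} (hP : P.Valid m)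
    {x : Set.Icc a b} (hx : 2 ≤ |scaled m x i₁ - P.top|) :
    ¬ IsApproxRoot ε (hidingField ε m i₀ i₁ i₂ P) x := by
  intro hroot
  have hX := scaled_mem hs hab m x
  have hsmall : ∀ i t, hidingField ε m i₀ i₁ i₂ P x i = 5 * ε * t → |t| ≤ 1 / 5 := by
    intro i t ht
    have h1 := (norm_le_pi_norm (hidingField ε m i₀ i₁ i₂ P x) i).trans hroot
    rw [ht, Real.norm_eq_abs, abs_mul, abs_of_pos (by linarith)] at h1
    have h2 : ε * (5 * |t|) ≤ ε * 1 := by linarith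
    linarith [le_of_mul_le_mul_left h2 hε]
  have k0 := hsmall i₀ _ (by simp only [hidingField, lift, if_true]; rfl)
  have k1 := hsmall i₁ _ (by simp only [hidingField, lift, if_neg h01.symm, if_true]; rfl)
  have k2 := hsmall i₂ _ (by
    simp only [hidingField, lift, if_neg h02.symm, if_neg h12.symm, if_true]; rfl)
  let p := (scaled m x i₀, scaled m x i₁)
  have g0 := abs_le_of_abs_clamped_le k0 k2
    (hP.horizontal_nonpos (p := p) (hX i₀) (hX i₁))
    (hP.horizontal_nonneg (p := p) (hX i₀) (hX i₁))
  have g1 := abs_le_of_abs_clamped_le k1 (by rwa [sub_right_comm])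
    (hP.vertical_nonpos (p := p) (hX i₀) (hX i₁)) (hP.vertical_nonneg (p := p))
  rcases hP.half_le (p := p) hx with h | h <;> linarith

end Lift

/-! ### Strips of width 4 and unused strips -/

section Blocks

/-- The index `k` of the block `[4 k - 2, 4 k + 2)` that contains `t`. -/
noncomputable def block (t : ℝ) : ℕ := ⌊(t + 2) / 4⌋₊

theorem two_le_abs_sub_of_block_ne {t : ℝ} (ht : 0 ≤ t) {k : ℕ} (h : block t ≠ k) :
    2 ≤ |t - (4 * k : ℤ)| := by
  by_contra hcon
  obtain ⟨h1, h2⟩ := abs_lt.1 (not_le.1 hcon)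
  push_cast at h1 h2
  exact h ((Nat.floor_eq_iff (by linarith)).2 ⟨by linarith, by linarith⟩)

theorem exists_pos_not_mem (l : List ℕ) : ∃ k, 1 ≤ k ∧ k ∉ l := by
  obtain ⟨k, hk⟩ := Infinite.exists_notMem_finset (insert 0 l.toFinset)
  simp only [Finset.mem_insert, List.mem_toFinset, not_or] at hk
  exact ⟨k, by omega, hk.2⟩

/-- Index 0 is excluded because that strip touches the side of the square. Minimality bounds the
index by the number of queries. -/
theorem exists_least_not_mem (l : List ℕ) :
    ∃ k, 1 ≤ k ∧ k ∉ l ∧ (∀ j, 1 ≤ j → j < k → j ∈ l) := by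
  classical
  have h := exists_pos_not_mem l
  exact ⟨Nat.find h, (Nat.find_spec h).1, (Nat.find_spec h).2, fun j hj hjk => by
    by_contra hcon
    exact Nat.find_min h hjk ⟨hj, hcon⟩⟩

theorem le_length_of_initial_segment {l : List ℕ} {k : ℕ} (h : ∀ j, 1 ≤ j → j < k → j ∈ l) :
    k ≤ l.length + 1 := by
  have h1 : Finset.Ico 1 k ⊆ l.toFinset := fun j hj => by
    rw [Finset.mem_Ico] at hj
    exact List.mem_toFinset.2 (h j hj.1 hj.2)
  have h2 := (Finset.card_le_card h1).trans l.toFinset_card_le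
  rw [Nat.card_Ico] at h2
  omega

end Blocks

/-! ### The adversary's strategy -/

section Invariant

variable {d : ℕ} {a b : Fin d → ℝ}

/-- The adversary's invariant: the history is explained by a hidden path that ends in the lowest
block of rows without queries. -/
def Explained (ε : ℝ) (m : ℕ) (i₀ i₁ i₂ : Fin d) (h : List (Set.Icc a b × (Fin d → ℝ))) : Prop :=
  ∃ (P : LatticePath) (r : ℕ), P.Valid m ∧ P.top = 4 * r ∧ 1 ≤ r ∧
    (∀ q ∈ h, hidingField ε m i₀ i₁ i₂ P q.1 = q.2 ∧ block (scaled m q.1 i₁) ≠ r) ∧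
    ∀ j, 1 ≤ j → j < r → ∃ q ∈ h, block (scaled m q.1 i₁) = j

variable {ε s : ℝ} {m : ℕ} {i₀ i₁ i₂ : Fin d}

theorem Explained.nil (hm : 6 ≤ m) :
    Explained ε m i₀ i₁ i₂ ([] : List (Set.Icc a b × (Fin d → ℝ))) :=
  ⟨LatticePath.initial m, 1, LatticePath.initial_valid hm, rfl, le_rfl, by simp, fun j h1 h2 => by
    omega⟩

theorem Explained.step (hs : 0 < s) (hab : ∀ i, s ≤ b i - a i)
    {h : List (Set.Icc a b × (Fin d → ℝ))} (hlen : 4 * h.length + 10 ≤ m)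
    (hh : Explained ε m i₀ i₁ i₂ h) (x : Set.Icc a b) :
    ∃ y, Explained ε m i₀ i₁ i₂ (h ++ [(x, y)]) := by
  obtain ⟨P, r, hP, htop, hr, hcons, hleast⟩ := hh
  by_cases hx : block (scaled m x i₁) = r
  · obtain ⟨c, hc1, hc, hcleast⟩ := exists_least_not_mem (h.map fun q => block (scaled m q.1 i₀))
    obtain ⟨r', hr1, hr', hrleast⟩ := exists_least_not_mem
      (block (scaled m x i₁) :: h.map fun q => block (scaled m q.1 i₁))
    have hcl := le_length_of_initial_segment hcleast
    have hrl := le_length_of_initial_segment hrleast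
    simp only [List.length_cons, List.length_map] at hcl hrl
    simp only [List.mem_map, not_exists, not_and, List.mem_cons, not_or] at hc hr' hrleast
    -- Every strip from 1 to `r - 1` was queried before, and strip `r` is hit by `x`.
    have hrr : r < r' := by
      by_contra hcon
      rcases (not_lt.1 hcon).eq_or_lt with he | hlt
      · exact hr'.1 (by rw [hx, he])
      · obtain ⟨q, hq, hqj⟩ := hleast r' hr1 hlt
        exact hr'.2 q hq hqj
    have ht : P.top < 4 * (r' : ℤ) := by omega
    -- The answer at `x` comes from the prolonged path; it need not agree with the old one, as no
    -- earlier query lies in strip `r`.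
    refine ⟨hidingField ε m i₀ i₁ i₂ (P.turn (4 * c : ℤ) (4 * r' : ℤ)) x,
      P.turn (4 * c : ℤ) (4 * r' : ℤ), r',
      hP.turn (by omega) (by omega) ht (by omega), rfl, hr1, ?_, ?_⟩
    · intro q hq
      rw [List.mem_append, List.mem_singleton] at hq
      rcases hq with hq | rfl
      · refine ⟨?_, hr'.2 q hq⟩
        rw [← (hcons q hq).1]
        refine lift_congr ?_
        have hX := scaled_mem hs hab m q.1
        obtain ⟨e1, e2⟩ := LatticePath.turn_field_eq (P := P) (c := (4 * c : ℤ))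
          (p := (scaled m q.1 i₀, scaled m q.1 i₁)) ht
          (two_le_abs_sub_of_block_ne (hX i₀).1 (hc q hq))
          (by rw [htop]; exact two_le_abs_sub_of_block_ne (hX i₁).1 (hcons q hq).2)
        rw [e1, e2]
      · exact ⟨rfl, fun he => hr'.1 he.symm⟩
    · intro j hj hjr
      rcases hrleast j hj hjr with he | ⟨q, hq, hqj⟩
      · exact ⟨_, List.mem_append_right _ (List.mem_singleton_self _), he.symm⟩
      · exact ⟨q, List.mem_append_left _ hq, hqj⟩
  · refine ⟨hidingField ε m i₀ i₁ i₂ P x, P, r, hP, htop, hr, ?_, fun j h1 h2 => ?_⟩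
    · intro q hq
      rw [List.mem_append, List.mem_singleton] at hq
      rcases hq with hq | rfl
      · exact hcons q hq
      · exact ⟨rfl, hx⟩
    · obtain ⟨q, hq, hqj⟩ := hleast j h1 h2
      exact ⟨q, List.mem_append_left _ hq, hqj⟩

end Invariant

theorem exists_offDiag_subset (d : ℕ) {i₀ i₁ : Fin d} (h01 : i₀ ≠ i₁) :
    ∃ S : Finset (Fin d × Fin d), (∀ p ∈ S, p.1 ≠ p.2 ∧ p ≠ (i₀, i₁) ∧ p ≠ (i₁, i₀)) ∧
      S.card = d ^ 2 - d - 2 := by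
  refine ⟨((Finset.univ : Finset (Fin d)).offDiag.erase (i₀, i₁)).erase (i₁, i₀), ?_, ?_⟩
  · intro p hp
    simp only [Finset.mem_erase, Finset.mem_offDiag] at hp
    exact ⟨hp.2.2.2.2, hp.2.1, hp.1⟩
  · rw [Finset.card_erase_of_mem, Finset.card_erase_of_mem, Finset.offDiag_card, Finset.card_univ,
      Fintype.card_fin, pow_two]
    · omega
    · simpa using h01
    · simp [h01.symm, h01]

end RootFinding

theorem mainTheorem4 :
    ∃ c : ℝ, 0 < c ∧ ∃ K : ℝ, 0 < K ∧
      ∀ d : ℕ, 3 ≤ d →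
        ∃ S : Finset (Fin d × Fin d), (∀ p ∈ S, p.1 ≠ p.2) ∧ S.card = d ^ 2 - d - 2 ∧
          ∀ (a b : Fin d → ℝ) (s : ℝ), 0 < s → (∀ i, s ≤ b i - a i) →
            ∀ L ε : ℝ, 0 < L → 0 < ε → K ≤ s * L / ε →
              ∀ A : RootFinding.Algorithm (Set.Icc a b) (Fin d → ℝ),
                A.FindsApproxRoots ε (RootFinding.MonotoneSwitchingClass a b L S) →
                  ∃ f ∈ RootFinding.MonotoneSwitchingClass a b L S,
                    ∃ n z, A.HaltsWith f n z ∧ c * (s * L / ε) ≤ (n : ℝ) := by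
  -- With `N = s * L / ε`, `m ≈ N / 50` and `n ≈ N / 1000`, the room `4 * n + 10 ≤ m` follows from
  -- `N / 250 + 14 ≤ N / 50`, that is, `N ≥ 875`.
  refine ⟨1 / 1000, by norm_num, 1000, by norm_num, fun d hd => ?_⟩
  have h01 : (⟨0, by omega⟩ : Fin d) ≠ ⟨1, by omega⟩ := by simp
  have h02 : (⟨0, by omega⟩ : Fin d) ≠ ⟨2, by omega⟩ := by simp
  have h12 : (⟨1, by omega⟩ : Fin d) ≠ ⟨2, by omega⟩ := by simp
  obtain ⟨S, hS, hcard⟩ := RootFinding.exists_offDiag_subset d h01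
  refine ⟨S, fun p hp => (hS p hp).1, hcard, fun a b s hs hab L ε hL hε hK A hA => ?_⟩
  set N := s * L / ε with hN
  set m := ⌊N / 50⌋₊
  set n := ⌈1 / 1000 * N⌉₊
  have hm1 : (m : ℝ) ≤ N / 50 := Nat.floor_le (by linarith)
  have hm2 : N / 50 < m + 1 := Nat.lt_floor_add_one _
  have hn1 : 1 / 1000 * N ≤ n := Nat.le_ceil _
  have hn2 : (n : ℝ) < 1 / 1000 * N + 1 := Nat.ceil_lt_add_one (by linarith)
  have hmn : 4 * n + 10 ≤ m := by
    have : (4 * n + 10 : ℝ) < m + 1 := by linarith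
    have : 4 * n + 10 < m + 1 := by exact_mod_cast this
    omega
  have hmL : 50 * ε * m ≤ s * L := by
    have : s * L = N * ε := by rw [hN, div_mul_cancel₀ _ hε.ne']
    rw [this]
    have := mul_le_mul_of_nonneg_right hm1 hε.le
    linarith
  obtain ⟨f, hf, k, z, hk, hnk⟩ := A.exists_le_evaluations _ (RootFinding.IsApproxRoot ε)
    (RootFinding.Explained ε m ⟨0, by omega⟩ ⟨1, by omega⟩ ⟨2, by omega⟩) n
    (RootFinding.Explained.nil (by omega))
    (fun h hlen hh x => hh.step hs hab (by omega) x)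
    (fun h ⟨P, r, hP, htop, _, hcons, _⟩ =>
      ⟨_, RootFinding.hidingField_mem_class hs hab hε h01 h02 h12 hmL hS P, fun q hq =>
        ⟨(hcons q hq).1, RootFinding.not_isApproxRoot_hidingField hs hab hε h01 h02 h12 hP (by
          rw [htop]
          exact RootFinding.two_le_abs_sub_of_block_ne (RootFinding.scaled_mem hs hab m q.1 _).1
            (hcons q hq).2)⟩⟩) hA
  exact ⟨f, hf, k, z, hk, hn1.trans (by exact_mod_cast hnk)⟩
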